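/- For $n,m\in\mathbb N$, call a map $g:\mathbb R^{n}\to\mathbb R^{m}$ a *superposition layer* if there are continuous functions $\Psi_{q,p}:\mathbb R\to\mathbb R$ and $\Phi_{i,q}:\mathbb R\to\mathbb R$ ($0\le q\le 2n$, $1\le p\le n$, $1\le i\le m$) such that $$g(x)_i=\sum_{q=0}^{2n}\Phi_{i,q}\Bigl(\sum_{p=1}^{n}\Psi_{q,p}(x_p)\Bigr)\qquad (x\in\mathbb R^n,\ 1\le i\le m).$$ A network of structure $(n,w_1,\dots,w_h,m)$ is a composition of superposition layers $\mathbb R^{n}\to\mathbb R^{w_1}\to\cdots\to\mathbb R^{w_h}\to\mathbb R^{m}$; the $w_j$ are its hidden widths. **Corollary 1.** A network of sufficiently large structure can simulate every continuous mapping from a space of arbitrary dimension to another one. Precisely: for all $n,m\in\mathbb N$ there is $N\in\mathbb N$ such that for every structure $(n,w_1,\dots,w_h,m)$ with $h\ge N$ and $w_j\ge N$ for all $j$, every closed set $\mathcal A\subseteq\mathbb R^n$, every set $\mathcal B\subseteq\mathbb R^m$ and every continuous mapping $f:\mathcal A\to\mathcal B$, there is a network of this structure whose function coincides with $f$ on $\mathcal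 A$. -/

import Mathlib

/-- A layer between a feature map of width `n` and a feature map of width `m`, given by continuous
one-dimensional inner functions `Ψ q p` and outer functions `Φ i q`, where `q = 0, …, 2n`,
`p` runs over the `n` inputs and `i` over the `m` outputs. -/
structure SuperpositionLayer (n m : ℕ) where
  /-- The inner functions; they are shared by all output coordinates. -/
  Ψ : Fin (2 * n + 1) → Fin n → C(ℝ, ℝ)
  /-- The outer functions, for each output coordinate. -/
  Φ : Fin m → Fin (2 * n + 1) → C(ℝ, ℝ)

/-- The mapping of a layer: `x ↦ (∑_q Φ_{i,q} (∑_p Ψ_{q,p} (x_p)))_i`. -/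
def SuperpositionLayer.eval {n m : ℕ} (s : SuperpositionLayer n m) (x : Fin n → ℝ) : Fin m → ℝ :=
  fun i => ∑ q, s.Φ i q (∑ p, s.Ψ q p (x p))

/-- Networks with input width `n`, output width `m` and a given list of hidden widths (the
structure of the network), each two adjacent feature maps being joined by a layer. -/
inductive SuperpositionNetwork : ℕ → List ℕ → ℕ → Type
  | output {n m : ℕ} (s : SuperpositionLayer n m) : SuperpositionNetwork n [] m
  | cons {n k m : ℕ} {ws : List ℕ} (s : SuperpositionLayer n k)
      (net : SuperpositionNetwork k ws m) : SuperpositionNetwork n (k :: ws) m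

/-- The function of a network: the composition of the mappings of its layers. -/
def SuperpositionNetwork.eval {n : ℕ} {ws : List ℕ} {m : ℕ} :
    SuperpositionNetwork n ws m → (Fin n → ℝ) → (Fin m → ℝ)
  | .output s => s.eval
  | .cons s net => net.eval ∘ s.eval

/-! This is a Kolmogorov superposition argument in the Baire category style of Kahane. On the cube,
take `K = 8 n + 1` shifted grids with small gaps between cells. Each coordinate falls in a gap for
at most one shift, so all but `n` shifts see a given point inside a product of cells. Inner
functions can be perturbed so that their sums separate these products; outer functions then
reproduce `f / K` there, and the `n` bad terms cost little (`exists_inner_near_superpose_approx`).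
Baire's theorem gives inner functions good for all `f` at once, and iterating on the residual makes
the representation exact.

On `ℝⁿ`, which is not compact, `F` is divided by a fast growing function `ρ` of the `ℓ¹`-norm. The
quotient vanishes at infinity, so it extends by zero from the open cube (via the sigmoid) to the
closed one. The product with `ρ` is formed by one more layer, through polarization. Wide feature
maps make room for `8 n + 2` inner sums, and surplus layers copy. Tietze's theorem reduces closed
sets to `ℝⁿ`. -/

open scoped unitInterval BoundedContinuousFunction

/-! ### Separating products of cells by sums -/

/-- A family of continuous functions on the unit interval can be perturbed so that, on a closed set
cut into finitely many clopen cells, each member is constant on each cell and the sums of the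
members separate the products of cells. -/
theorem exists_perturbation_separating_cells {n m : ℕ} {G : Set I} (hG : IsClosed G)
    {a : G → Fin m} (ha : Continuous a) (r : Fin m → I) (ψ : Fin n → C(I, ℝ)) {ε : ℝ}
    (hε : 0 < ε) (hψ : ∀ p, ∀ t : G, |ψ p t - ψ p (r (a t))| ≤ ε) :
    ∃ ψ' : Fin n → C(I, ℝ), (∀ p, ‖ψ' p - ψ p‖ ≤ 2 * ε) ∧
      ∃ e : (Fin n → Fin m) → ℝ, Function.Injective e ∧
        ∀ x : Fin n → G, ∑ p, ψ' p (x p) = e fun p => a (x p) := by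
  -- The `+ 1` keeps `L` positive even when `m ^ n = 0`.
  obtain ⟨L, hL⟩ : ∃ L : ℕ, L = m ^ n + 1 := ⟨_, rfl⟩
  have hL0 : (0 : ℝ) < L := by rw [hL]; positivity
  have hδ : 0 < ε / L := by positivity
  let z : Fin n → Fin m → ℤ := fun p i => ⌊ψ p (r i) / ε⌋
  -- Round down to a multiple of `ε`, then add the base-`m` digit `i` at place `p` in units of `ε /
  -- L`. In these units the sum over `p` is, modulo `L`, the number whose digits are the cell
  -- indices.
  let v : Fin n → Fin m → ℝ := fun p i => ε * z p i + ε / L * ((i : ℕ) * m ^ (p : ℕ) : ℕ)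
  have hv : ∀ p i, |v p i - ψ p (r i)| ≤ ε := by
    intro p i
    have h1 : (z p i : ℝ) * ε ≤ ψ p (r i) := (le_div_iff₀ hε).1 (Int.floor_le _)
    have h2 : ψ p (r i) < ((z p i : ℝ) + 1) * ε := (div_lt_iff₀ hε).1 (Int.lt_floor_add_one _)
    have h3 : ((i : ℕ) * m ^ (p : ℕ) : ℕ) ≤ L := by
      have hm : 0 < m := i.pos
      calc (i : ℕ) * m ^ (p : ℕ) ≤ m * m ^ (p : ℕ) := Nat.mul_le_mul_right _ i.2.le
        _ = m ^ ((p : ℕ) + 1) := by ring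
        _ ≤ m ^ n := Nat.pow_le_pow_right hm p.2
        _ ≤ L := by omega
    have h4 : ε / L * ((i : ℕ) * m ^ (p : ℕ) : ℕ) ≤ ε := by
      calc ε / L * ((i : ℕ) * m ^ (p : ℕ) : ℕ) ≤ ε / L * L := by gcongr
        _ = ε := by field_simp
    have h5 : 0 ≤ ε / L * ((i : ℕ) * m ^ (p : ℕ) : ℕ) := by positivity
    rw [abs_le]
    simp only [v]
    constructor <;> linarith
  have hext : ∀ p, ∃ g : I →ᵇ ℝ, ‖g‖ ≤ 2 * ε ∧ ∀ t : G, g t = v p (a t) - ψ p t := by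
    intro p
    let u : C(G, ℝ) := ⟨fun t => v p (a t) - ψ p t, by
      have : Continuous (v p) := continuous_of_discreteTopology
      fun_prop⟩
    have hu : ∀ t, ‖u t‖ ≤ 2 * ε := by
      intro t
      have h1 := hv p (a t)
      have h2 := hψ p t
      rw [abs_le] at h1 h2
      change |v p (a t) - ψ p t| ≤ _
      rw [abs_le]
      constructor <;> linarith [h1.1, h1.2, h2.1, h2.2]
    obtain ⟨g, hg, hge⟩ := BoundedContinuousFunction.exists_extension_norm_eq_of_isClosedEmbedding
      (BoundedContinuousFunction.ofNormedAddCommGroup u u.continuous (2 * ε) hu)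
      hG.isClosedEmbedding_subtypeVal
    refine ⟨g, ?_, fun t => congrFun hge t⟩
    rw [hg]
    exact BoundedContinuousFunction.norm_ofNormedAddCommGroup_le _ (by positivity) hu
  choose g hg hgt using hext
  refine ⟨fun p => ψ p + (g p).toContinuousMap, fun p => ?_, fun b => ∑ p, v p (b p), ?_, ?_⟩
  · rw [add_sub_cancel_left, ContinuousMap.norm_le _ (by positivity)]
    exact fun t => ((g p).norm_coe_le_norm t).trans (hg p)
  · intro b c hbc
    have hsum : ∀ b : Fin n → Fin m, ∑ p, v p (b p) =
        ε / L * ((L * ∑ p, z p (b p) + (finFunctionFinEquiv b : ℕ) : ℤ) : ℝ) := by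
      intro b
      rw [finFunctionFinEquiv_apply]
      simp only [v, Finset.sum_add_distrib, ← Finset.mul_sum]
      push_cast
      rw [mul_add, ← mul_assoc, div_mul_cancel₀ _ hL0.ne']
    simp only [hsum] at hbc
    have h := Int.cast_injective (mul_left_cancel₀ hδ.ne' hbc)
    have hlt : ∀ b : Fin n → Fin m, (finFunctionFinEquiv b : ℕ) < L := fun b => by
      have := (finFunctionFinEquiv b).2
      omega
    have h' := congrArg (fun k : ℤ => k % L) h
    simp only [Int.mul_add_emod_self_left] at h'
    apply finFunctionFinEquiv.injective
    apply Fin.ext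
    rwa [Int.emod_eq_of_lt (by positivity) (by exact_mod_cast hlt b),
      Int.emod_eq_of_lt (by positivity) (by exact_mod_cast hlt c), Nat.cast_inj] at h'
  · intro x
    refine Finset.sum_congr rfl fun p _ => ?_
    change ψ p (x p) + g p (x p) = _
    rw [hgt]
    ring

/-! ### Shifted grids and approximation on the cube -/

/-- The superposition `x ↦ ∑_q Φ_q (∑_p ψ_{q,p} (x_p))` on the unit cube. -/
def superpose {n K : ℕ} (Φ : Fin K → C(ℝ, ℝ)) (ψ : Fin K → Fin n → C(I, ℝ)) :
    C(Fin n → I, ℝ) :=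
  ∑ q, (Φ q).comp (∑ p, (ψ q p).comp ⟨fun x => x p, continuous_apply p⟩)

theorem superpose_apply {n K : ℕ} (Φ : Fin K → C(ℝ, ℝ)) (ψ : Fin K → Fin n → C(I, ℝ))
    (x : Fin n → I) : superpose Φ ψ x = ∑ q, Φ q (∑ p, ψ q p (x p)) := by
  simp [superpose, ContinuousMap.sum_apply]

theorem continuous_superpose {n K : ℕ} (Φ : Fin K → C(ℝ, ℝ)) :
    Continuous (superpose (n := n) Φ) := by
  unfold superpose
  refine continuous_finsetSum _ fun q _ => ?_
  refine (ContinuousMap.continuous_postcomp (Φ q)).comp ?_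
  refine continuous_finsetSum _ fun p _ => ?_
  exact (ContinuousMap.continuous_precomp _).comp (by fun_prop)

/-- The points of the unit interval at distance at least `1 / (2 K)` from the cell boundaries, after
scaling by `M` and shifting by `(q + 1/2) / K`. -/
def gridCells (K M : ℕ) (q : Fin K) : Set I :=
  {t | ∀ i : ℤ, 1 / (2 * K : ℝ) ≤ |M * (t : ℝ) - (q + 1 / 2) / K - i|}

theorem isClosed_gridCells (K M : ℕ) (q : Fin K) : IsClosed (gridCells K M q) := by
  simp only [gridCells, Set.ofPred_forall]
  exact isClosed_iInter fun i => isClosed_le (by fun_prop) (by fun_prop)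

/-- After scaling, the gaps are open intervals of radius `1 / (2 K)` about centres which, for
distinct shifts, differ by at least `1 / K` modulo 1; hence they are disjoint. -/
theorem eq_of_notMem_gridCells {K M : ℕ} {q q' : Fin K} {t : I} (h : t ∉ gridCells K M q)
    (h' : t ∉ gridCells K M q') : q = q' := by
  have hK : (0 : ℝ) < K := by exact_mod_cast q.pos
  simp only [gridCells, Set.mem_ofPred_eq, not_forall, not_le] at h h'
  obtain ⟨i, hi⟩ := h
  obtain ⟨j, hj⟩ := h'
  have hz : |(((q : ℤ) - q' + K * (i - j) : ℤ) : ℝ)| < 1 := by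
    have e : (((q : ℤ) - q' + K * (i - j) : ℤ) : ℝ) =
        K * ((M * (t : ℝ) - (q' + 1 / 2) / K - j) - (M * (t : ℝ) - (q + 1 / 2) / K - i)) := by
      push_cast
      field_simp
      ring
    rw [e, abs_mul, abs_of_pos hK]
    calc _ ≤ (K : ℝ) * (|M * (t : ℝ) - (q' + 1 / 2) / K - j| +
          |M * (t : ℝ) - (q + 1 / 2) / K - i|) := by
            gcongr
            exact abs_sub _ _
      _ < K * (1 / (2 * K) + 1 / (2 * K)) := by gcongr
      _ = 1 := by field_simp; norm_num
  have hz' : |((q : ℤ) - q' + K * (i - j))| < 1 := by exact_mod_cast hz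
  have h0 := Int.abs_lt_one_iff.1 hz'
  have hmod : ((q : ℕ) : ℤ) % K = ((q' : ℕ) : ℤ) % K := by
    have : ((q : ℕ) : ℤ) = q' + K * (j - i) := by linarith
    rw [this, Int.add_mul_emod_self_left]
  rw [Int.emod_eq_of_lt (by positivity) (by exact_mod_cast q.2),
    Int.emod_eq_of_lt (by positivity) (by exact_mod_cast q'.2)] at hmod
  exact Fin.ext (by exact_mod_cast hmod)

/-- The index is a floor, locally constant because its jumps lie in the gaps. The shift `1 - c` in
place of `-c` makes the argument nonnegative; it stays below `M + 1`, hence `M + 1` cells. -/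
theorem exists_gridCells_index (K M : ℕ) (hM : 0 < M) (q : Fin K) :
    ∃ a : gridCells K M q → Fin (M + 1), Continuous a ∧
      ∃ r : Fin (M + 1) → I, ∀ t : gridCells K M q, dist (t : I) (r (a t)) ≤ 1 / M := by
  have hK : (0 : ℝ) < K := by exact_mod_cast q.pos
  have hM' : (0 : ℝ) < M := by exact_mod_cast hM
  obtain ⟨c, hc⟩ : ∃ c : ℝ, c = (q + 1 / 2) / K := ⟨_, rfl⟩
  have hc0 : 0 < c := by rw [hc]; positivity
  have hc1 : c < 1 := by
    rw [hc, div_lt_one hK]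
    have : (q : ℝ) + 1 ≤ K := by exact_mod_cast q.2
    linarith
  let s : I → ℝ := fun t => M * (t : ℝ) + (1 - c)
  have hs0 : ∀ t, 0 ≤ s t := fun t => by
    have := mul_nonneg hM'.le t.2.1
    simp only [s]; linarith
  have hs1 : ∀ t, s t < M + 1 := fun t => by
    have := mul_le_mul_of_nonneg_left t.2.2 hM'.le
    simp only [s]; linarith
  refine ⟨fun t => ⟨⌊s t⌋₊, (Nat.floor_lt (hs0 t)).2 (by exact_mod_cast hs1 t)⟩, ?_,
    fun i => Set.projIcc 0 1 zero_le_one ((i : ℝ) / M), fun t => ?_⟩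
  · apply IsLocallyConstant.continuous
    rw [IsLocallyConstant.iff_eventually_eq]
    intro t
    have h1 : (⌊s t⌋₊ : ℝ) ≤ s t := Nat.floor_le (hs0 t)
    have h2 : s t < ⌊s t⌋₊ + 1 := Nat.lt_floor_add_one _
    have h3 : (⌊s t⌋₊ : ℝ) ≠ s t := by
      intro h
      have h4 := t.2 (⌊s t⌋₊ - 1)
      have : (M : ℝ) * (t : I) - (q + 1 / 2) / K - ((⌊s t⌋₊ - 1 : ℤ) : ℝ) = 0 := by
        push_cast
        rw [h, ← hc]
        simp only [s]; ring
      rw [this, abs_zero] at h4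
      have : (0 : ℝ) < 1 / (2 * K) := by positivity
      linarith
    have hcont : Continuous fun t : gridCells K M q => s t := by fun_prop
    filter_upwards [hcont.continuousAt.eventually_mem (Ioo_mem_nhds (lt_of_le_of_ne h1 h3) h2)]
      with y hy
    apply Fin.ext
    exact (Nat.floor_eq_iff (hs0 y)).2 ⟨hy.1.le, hy.2⟩
  · have h1 : (⌊s t⌋₊ : ℝ) ≤ s t := Nat.floor_le (hs0 t)
    have h2 : s t < ⌊s t⌋₊ + 1 := Nat.lt_floor_add_one _
    have h3 : dist (((t : I) : ℝ)) ((⌊s t⌋₊ : ℝ) / M) ≤ 1 / M := by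
      have e : (((t : I) : ℝ)) - (⌊s t⌋₊ : ℝ) / M = (M * ((t : I) : ℝ) - ⌊s t⌋₊) / M := by
        field_simp
      rw [Real.dist_eq, e, abs_div, abs_of_pos hM']
      gcongr
      simp only [s] at h1 h2 ⊢
      rw [abs_le]
      constructor <;> linarith
    refine le_trans ?_ h3
    conv_lhs => rw [← Set.projIcc_val (zero_le_one' ℝ) (t : I)]
    exact Set.abs_projIcc_sub_projIcc (zero_le_one' ℝ)

/-- For a nonzero `f` and any inner functions there are inner functions nearby and bounded outer
functions whose superposition approximates `f` up to a relative error of one half. -/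
theorem exists_inner_near_superpose_approx {n K : ℕ} (hK : 8 * n < K)
    (f : C(Fin n → I, ℝ)) (hf : f ≠ 0)
    (ψ : Fin K → Fin n → C(I, ℝ)) {ε : ℝ} (hε : 0 < ε) :
    ∃ ψ' : Fin K → Fin n → C(I, ℝ), dist ψ' ψ ≤ ε ∧
      ∃ Φ : Fin K → ℝ →ᵇ ℝ, (∀ q, ‖Φ q‖ ≤ ‖f‖) ∧
        ‖f - superpose (fun q => (Φ q).toContinuousMap) ψ'‖ < ‖f‖ / 2 := by
  have hK0 : (0 : ℝ) < K := by exact_mod_cast (Nat.zero_le _).trans_lt hK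
  have hK8 : 8 * (n : ℝ) ≤ K := by exact_mod_cast hK.le
  have hf0 : 0 < ‖f‖ := norm_pos_iff.2 hf
  have hη : 0 < ‖f‖ / 8 := by positivity
  have huf := CompactSpace.uniformContinuous_of_continuous f.continuous
  obtain ⟨d₁, hd₁, hfd⟩ := Metric.uniformContinuous_iff.1 huf _ hη
  have huψ : UniformContinuous fun t : I => fun q p => ψ q p t :=
    CompactSpace.uniformContinuous_of_continuous (by fun_prop)
  obtain ⟨d₂, hd₂, hψd⟩ := Metric.uniformContinuous_iff.1 huψ (ε / 2) (by positivity)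
  obtain ⟨M, hM⟩ := exists_nat_one_div_lt (lt_min hd₁ hd₂)
  have key : ∀ q : Fin K, ∃ ψ' : Fin n → C(I, ℝ), ∃ Φ : ℝ →ᵇ ℝ, (∀ p, ‖ψ' p - ψ q p‖ ≤ ε) ∧
      ‖Φ‖ ≤ ‖f‖ / K ∧ ∀ x : Fin n → I, (∀ p, x p ∈ gridCells K (M + 1) q) →
        |f x / K - Φ (∑ p, ψ' p (x p))| ≤ ‖f‖ / 8 / K := by
    intro q
    obtain ⟨a, ha, r, hr⟩ := exists_gridCells_index K (M + 1) M.succ_pos q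
    have hr' : ∀ t : gridCells K (M + 1) q, dist (t : I) (r (a t)) < min d₁ d₂ := fun t =>
      (hr t).trans_lt (by exact_mod_cast hM)
    obtain ⟨ψ', hψ', e, he, hsum⟩ := exists_perturbation_separating_cells
      (isClosed_gridCells K (M + 1) q) ha r (ψ q) (half_pos hε) (fun p t => by
        have h := hψd ((hr' t).trans_le (min_le_right _ _))
        exact (((dist_pi_lt_iff (half_pos hε)).1 ((dist_pi_lt_iff (half_pos hε)).1 h q)) p).le)
    have hce : Topology.IsClosedEmbedding e :=
      (continuous_of_discreteTopology (f := e)).isClosedEmbedding he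
    let u : (Fin n → Fin (M + 1 + 1)) → ℝ := fun b => f (fun p => r (b p)) / K
    have hu : ∀ b, ‖u b‖ ≤ ‖f‖ / K := fun b => by
      simp only [u, norm_div, Real.norm_natCast]
      gcongr
      exact f.norm_coe_le_norm _
    obtain ⟨Φ, hΦ, hΦe⟩ :=
      BoundedContinuousFunction.exists_extension_norm_eq_of_isClosedEmbedding
      (BoundedContinuousFunction.ofNormedAddCommGroup u continuous_of_discreteTopology _ hu) hce
    refine ⟨ψ', Φ, fun p => (hψ' p).trans (by linarith), ?_, fun x hx => ?_⟩
    · rw [hΦ]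
      exact BoundedContinuousFunction.norm_ofNormedAddCommGroup_le _ (by positivity) hu
    · have h1 := hsum fun p => ⟨x p, hx p⟩
      have h2 : Φ (e fun p => a ⟨x p, hx p⟩) = f (fun p => r (a ⟨x p, hx p⟩)) / K :=
        congrFun hΦe _
      simp only at h1
      rw [h1, h2, ← sub_div, abs_div, abs_of_pos hK0]
      gcongr
      refine (hfd ?_).le
      exact (dist_pi_lt_iff hd₁).2 fun p => (hr' ⟨x p, hx p⟩).trans_le (min_le_left _ _)
  choose ψ' Φ hψ' hΦ hgood using key
  have hΦ1 : ∀ q t, |Φ q t| ≤ ‖f‖ / K := fun q t => ((Φ q).norm_coe_le_norm t).trans (hΦ q)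
  refine ⟨ψ', ?_, Φ, fun q => (hΦ q).trans ?_, ?_⟩
  · refine (dist_pi_le_iff hε.le).2 fun q => (dist_pi_le_iff hε.le).2 fun p => ?_
    rw [dist_eq_norm]
    exact hψ' q p
  · refine div_le_self hf0.le ?_
    exact_mod_cast (Nat.zero_le _).trans_lt hK
  -- The good shifts contribute at most `‖f‖ / 8`, and at most `n` bad ones `2 * ‖f‖ / K` each, in
  -- total at most `‖f‖ / 4` since `8 * n ≤ K`.
  · refine lt_of_le_of_lt ((ContinuousMap.norm_le _ (by positivity)).2 fun x => ?_)
      (show 3 / 8 * ‖f‖ < ‖f‖ / 2 by linarith)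
    classical
    let bad : Finset (Fin K) := Finset.univ.biUnion fun p : Fin n =>
      Finset.univ.filter fun q => x p ∉ gridCells K (M + 1) q
    have hbad : bad.card ≤ n := by
      refine (Finset.card_biUnion_le_card_mul _ _ 1 fun p _ => ?_).trans (by simp)
      refine Finset.card_le_one.2 fun q hq q' hq' => ?_
      exact eq_of_notMem_gridCells (Finset.mem_filter.1 hq).2 (Finset.mem_filter.1 hq').2
    have hterm : ∀ q, |f x / K - Φ q (∑ p, ψ' q p (x p))| ≤
        ‖f‖ / 8 / K + if q ∈ bad then 2 * (‖f‖ / K) else 0 := by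
      intro q
      split_ifs with hq
      · have h1 : |f x / K| ≤ ‖f‖ / K := by
          rw [abs_div, abs_of_pos hK0]
          gcongr
          exact f.norm_coe_le_norm _
        have h2 := abs_sub (f x / K) (Φ q (∑ p, ψ' q p (x p)))
        have h3 := hΦ1 q (∑ p, ψ' q p (x p))
        have h4 : 0 ≤ ‖f‖ / 8 / K := by positivity
        linarith
      · rw [add_zero]
        refine hgood q x fun p => ?_
        by_contra h
        exact hq (Finset.mem_biUnion.2 ⟨p, Finset.mem_univ _, by simpa using h⟩)
    have hfx : (f - superpose (fun q => (Φ q).toContinuousMap) ψ') x =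
        ∑ q, (f x / K - Φ q (∑ p, ψ' q p (x p))) := by
      rw [ContinuousMap.sub_apply, superpose_apply, Finset.sum_sub_distrib]
      simp only [Finset.sum_const, Finset.card_univ, Fintype.card_fin, nsmul_eq_mul]
      rw [mul_div_cancel₀ _ hK0.ne']
      rfl
    rw [hfx]
    calc ‖∑ q, (f x / K - Φ q (∑ p, ψ' q p (x p)))‖
        ≤ ∑ q, |f x / K - Φ q (∑ p, ψ' q p (x p))| := norm_sum_le _ _
      _ ≤ ∑ q : Fin K, (‖f‖ / 8 / K + if q ∈ bad then 2 * (‖f‖ / K) else 0) :=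
        Finset.sum_le_sum fun q _ => hterm q
      _ = ‖f‖ / 8 + bad.card * (2 * (‖f‖ / K)) := by
        rw [Finset.sum_add_distrib, Finset.sum_ite_mem]
        simp only [Finset.sum_const, Finset.card_univ, Fintype.card_fin, nsmul_eq_mul,
          Finset.univ_inter]
        rw [mul_div_cancel₀ _ hK0.ne']
      _ ≤ ‖f‖ / 8 + n * (2 * (‖f‖ / K)) := by gcongr
      _ ≤ 3 / 8 * ‖f‖ := by
        have : (n : ℝ) * (2 * (‖f‖ / K)) ≤ ‖f‖ / 4 := by
          rw [show (n : ℝ) * (2 * (‖f‖ / K)) = (2 * n * ‖f‖) / K by ring, div_le_iff₀ hK0]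
          nlinarith
        linarith

/-! ### Universal inner functions by Baire category -/

/-- There are inner functions for which every nonzero function is approximated, up to a relative
error of three quarters, by a superposition with outer functions of comparable norm. -/
theorem exists_inner_forall_superpose_approx (n : ℕ) :
    ∃ ψ : Fin (8 * n + 1) → Fin n → C(I, ℝ), ∀ f : C(Fin n → I, ℝ),
      ∃ Φ : Fin (8 * n + 1) → ℝ →ᵇ ℝ, ‖Φ‖ ≤ 2 * ‖f‖ ∧
        ‖f - superpose (fun q => (Φ q).toContinuousMap) ψ‖ ≤ 3 / 4 * ‖f‖ := by
  let U : C(Fin n → I, ℝ) → Set (Fin (8 * n + 1) → Fin n → C(I, ℝ)) := fun f =>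
    ⋃ Φ ∈ {Φ : Fin (8 * n + 1) → ℝ →ᵇ ℝ | ∀ q, ‖Φ q‖ ≤ ‖f‖},
      {ψ | ‖f - superpose (fun q => (Φ q).toContinuousMap) ψ‖ < ‖f‖ / 2}
  have hUo : ∀ f, IsOpen (U f) := fun f => isOpen_biUnion fun Φ _ =>
    isOpen_lt ((continuous_const.sub (continuous_superpose _)).norm) continuous_const
  -- The strict inequality makes `U 0` empty, so zero is treated separately.
  have hUd : ∀ f, f ≠ 0 → Dense (U f) := by
    intro f hf ψ
    rw [Metric.mem_closure_iff]
    intro ε hε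
    obtain ⟨ψ', hψ', Φ, hΦ, h⟩ := exists_inner_near_superpose_approx (Nat.lt_succ_self _) f hf ψ (half_pos hε)
    refine ⟨ψ', Set.mem_biUnion (show Φ ∈ {Φ : Fin (8 * n + 1) → ℝ →ᵇ ℝ | ∀ q, ‖Φ q‖ ≤ ‖f‖}
      from hΦ) h, ?_⟩
    rw [dist_comm]
    linarith
  obtain ⟨D, hDc, hDd⟩ := TopologicalSpace.exists_countable_dense C(Fin n → I, ℝ)
  have : Countable {f : C(Fin n → I, ℝ) // f ∈ D ∧ f ≠ 0} :=
    (hDc.mono fun f (hf : f ∈ D ∧ f ≠ 0) => hf.1).to_subtype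
  have : BaireSpace (Fin (8 * n + 1) → Fin n → C(I, ℝ)) :=
    BaireSpace.of_completelyPseudoMetrizable
  obtain ⟨ψ, hψ⟩ := (dense_iInter_of_isOpen
    (f := fun f : {f : C(Fin n → I, ℝ) // f ∈ D ∧ f ≠ 0} => U f)
    (fun f => hUo f) fun f => hUd f f.2.2).nonempty
  refine ⟨ψ, fun g => ?_⟩
  by_cases hg : g = 0
  · refine ⟨0, by simp, ?_⟩
    have : superpose (fun q => ((0 : Fin (8 * n + 1) → ℝ →ᵇ ℝ) q).toContinuousMap) ψ = 0 := by
      ext x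
      simp [superpose_apply]
    rw [this, hg]
    simp
  have hg0 : 0 < ‖g‖ := norm_pos_iff.2 hg
  -- With `1 / 10` the relative error is at most `1/10 + 11/20 < 3/4`.
  obtain ⟨f, hfD, hfg⟩ := hDd.exists_dist_lt g (show 0 < ‖g‖ / 10 by positivity)
  rw [dist_eq_norm] at hfg
  have hn1 : ‖f‖ ≤ 11 / 10 * ‖g‖ := by
    have := norm_sub_norm_le f g
    rw [norm_sub_rev] at this
    linarith
  have hf0 : f ≠ 0 := by
    rintro rfl
    rw [sub_zero] at hfg
    linarith
  have hmem := Set.mem_iInter.1 hψ ⟨f, hfD, hf0⟩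
  simp only [U, Set.mem_iUnion] at hmem
  obtain ⟨Φ, hΦ, h⟩ := hmem
  refine ⟨Φ, (pi_norm_le_iff_of_nonneg (by positivity)).2 fun q => (hΦ q).trans (by linarith), ?_⟩
  have h' : ‖f - superpose (fun q => (Φ q).toContinuousMap) ψ‖ < ‖f‖ / 2 := h
  have := norm_add_le (g - f) (f - superpose (fun q => (Φ q).toContinuousMap) ψ)
  rw [sub_add_sub_cancel] at this
  linarith

/-! ### Exact representation by iterated correction -/

/-- A bounded linear map from a Banach space is onto if every vector has an approximate preimage of
comparable norm with relative error bounded by a constant less than one. -/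
theorem ContinuousLinearMap.surjective_of_approx_preimage {E F : Type*} [NormedAddCommGroup E]
    [NormedSpace ℝ E] [CompleteSpace E] [NormedAddCommGroup F] [NormedSpace ℝ F]
    (T : E →L[ℝ] F) {C θ : ℝ} (hC : 0 ≤ C) (hθ0 : 0 ≤ θ) (hθ : θ < 1)
    (h : ∀ y, ∃ x, ‖x‖ ≤ C * ‖y‖ ∧ ‖y - T x‖ ≤ θ * ‖y‖) : Function.Surjective T := by
  intro y
  choose A hA hT using h
  -- `r k` is the residual after `k` corrections; it decays geometrically, so the corrections are
  -- summable.
  let r : ℕ → F := fun k => (fun z => z - T (A z))^[k] y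
  have hr : ∀ k, r (k + 1) = r k - T (A (r k)) := fun k => Function.iterate_succ_apply' _ _ _
  have hrn : ∀ k, ‖r k‖ ≤ θ ^ k * ‖y‖ := by
    intro k
    induction k with
    | zero => simp [r]
    | succ k ih =>
      rw [hr, pow_succ', mul_assoc]
      exact (hT _).trans (by gcongr)
  have hs : Summable fun k => A (r k) := by
    refine Summable.of_norm_bounded
      (((summable_geometric_of_lt_one hθ0 hθ).mul_right ‖y‖).mul_left C) fun k => ?_
    exact (hA _).trans (by gcongr; exact hrn k)
  have hlim : Filter.Tendsto r Filter.atTop (nhds 0) := by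
    refine squeeze_zero_norm hrn ?_
    simpa using (tendsto_pow_atTop_nhds_zero_of_lt_one hθ0 hθ).mul_const ‖y‖
  have hsum : ∀ k, ∑ i ∈ Finset.range k, T (A (r i)) = y - r k := by
    intro k
    induction k with
    | zero => simp [r]
    | succ k ih => rw [Finset.sum_range_succ, ih, hr]; abel
  refine ⟨∑' k, A (r k), ?_⟩
  have h1 := (T.hasSum hs.hasSum).tendsto_sum_nat
  refine tendsto_nhds_unique h1 ?_
  simp only [hsum]
  simpa using tendsto_const_nhds.sub hlim

/-- Superposition theorem on the unit cube, with inner functions independent of `f`. -/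
theorem exists_inner_forall_eq_superpose (n : ℕ) :
    ∃ ψ : Fin (8 * n + 1) → Fin n → C(I, ℝ), ∀ f : C(Fin n → I, ℝ),
      ∃ Φ : Fin (8 * n + 1) → C(ℝ, ℝ), ∀ x, f x = ∑ q, Φ q (∑ p, ψ q p (x p)) := by
  obtain ⟨ψ, hψ⟩ := exists_inner_forall_superpose_approx n
  refine ⟨ψ, fun f => ?_⟩
  let T₀ : (Fin (8 * n + 1) → ℝ →ᵇ ℝ) →ₗ[ℝ] C(Fin n → I, ℝ) :=
    { toFun := fun Φ => superpose (fun q => (Φ q).toContinuousMap) ψ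
      map_add' := fun Φ Φ' => by
        ext x
        simp [superpose_apply, Finset.sum_add_distrib]
      map_smul' := fun c Φ => by
        ext x
        simp [superpose_apply, Finset.mul_sum] }
  let T : (Fin (8 * n + 1) → ℝ →ᵇ ℝ) →L[ℝ] C(Fin n → I, ℝ) :=
    T₀.mkContinuous ((8 * n + 1 : ℕ) : ℝ) fun Φ => by
      refine (ContinuousMap.norm_le _ (by positivity)).2 fun x => ?_
      change ‖superpose (fun q => (Φ q).toContinuousMap) ψ x‖ ≤ _
      rw [superpose_apply]
      refine (norm_sum_le_of_le _ (f := fun q => Φ q (∑ p, ψ q p (x p))) (n := fun _ => ‖Φ‖)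
        fun q _ => ((Φ q).norm_coe_le_norm _).trans (norm_le_pi_norm Φ q)).trans ?_
      simp
  obtain ⟨Φ, hΦ⟩ := T.surjective_of_approx_preimage (C := 2) (θ := 3 / 4) (by norm_num)
    (by norm_num) (by norm_num) hψ f
  refine ⟨fun q => (Φ q).toContinuousMap, fun x => ?_⟩
  rw [← superpose_apply, ← hΦ]
  rfl

/-! ### From the cube to `ℝⁿ` -/

theorem unitInterval.isOpenEmbedding_sigmoid : Topology.IsOpenEmbedding unitInterval.sigmoid :=
  ⟨Topology.isEmbedding_sigmoid, by rw [unitInterval.range_sigmoid]; exact isOpen_Ioo⟩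

/-- Extension by zero along an open embedding preserves continuity of functions that vanish at
infinity. -/
theorem Topology.IsOpenEmbedding.continuous_extend_zero {X Y E : Type*} [TopologicalSpace X]
    [TopologicalSpace Y] [T2Space Y] [TopologicalSpace E] [Zero E] {e : X → Y}
    (he : Topology.IsOpenEmbedding e) {h : X → E} (hc : Continuous h)
    (h0 : Filter.Tendsto h (Filter.cocompact X) (nhds 0)) : Continuous (Function.extend e h 0) := by
  have hcomp : Function.extend e h 0 ∘ e = h := funext fun x => he.injective.extend_apply _ _ _
  rw [continuous_iff_continuousAt]
  intro y
  by_cases hy : y ∈ Set.range e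
  · obtain ⟨x, rfl⟩ := hy
    rw [← he.continuousAt_iff, hcomp]
    exact hc.continuousAt
  · rw [ContinuousAt, Function.extend_apply' _ _ _ (by simpa using hy)]
    intro V hV
    have hV' := h0 hV
    obtain ⟨C, hC, hCV⟩ := Filter.mem_cocompact.1 hV'
    have hyC : y ∉ e '' C := fun h => hy (Set.image_subset_range _ _ h)
    rw [Filter.mem_map]
    filter_upwards [(hC.image he.continuous).isClosed.isOpen_compl.mem_nhds hyC] with z hz
    by_cases hz' : z ∈ Set.range e
    · obtain ⟨x, rfl⟩ := hz'
      have hx : x ∈ Cᶜ := fun h => hz (Set.mem_image_of_mem _ h)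
      rw [Set.mem_preimage, he.injective.extend_apply]
      exact hCV hx
    · rw [Set.mem_preimage, Function.extend_apply' _ _ _ (by simpa using hz')]
      exact mem_of_mem_nhds hV

theorem norm_le_sum_abs {n : ℕ} (x : Fin n → ℝ) : ‖x‖ ≤ ∑ p, |x p| :=
  (pi_norm_le_iff_of_nonneg (Finset.sum_nonneg fun _ _ => abs_nonneg _)).2 fun p =>
    Finset.single_le_sum (f := fun p => |x p|) (fun _ _ => abs_nonneg _) (Finset.mem_univ p)

/-- A continuous function on `ℝⁿ` is dominated by a continuous function of the `ℓ¹`-norm. -/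
theorem exists_continuous_dominating {n : ℕ} (F : C(Fin n → ℝ, ℝ)) :
    ∃ ρ : C(ℝ, ℝ), ∀ x, (1 + ∑ p, |x p|) * (1 + |F x|) ≤ ρ (∑ p, |x p|) := by
  -- The admissible values at `s` form a convex set, and a bound over the ball of radius `s + 1` is
  -- admissible at all nearby `s'`; a partition of unity glues these constants.
  obtain ⟨ρ, hρ⟩ := exists_continuous_forall_mem_convex_of_local_const (X := ℝ) (E := ℝ)
    (t := fun s => Set.Ici 0 ∩ {c | ∀ x : Fin n → ℝ, ∑ p, |x p| ≤ s →
      (1 + ∑ p, |x p|) * (1 + |F x|) ≤ c})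
    (fun s => ((convex_Ici 0).inter (by
      rw [show {c : ℝ | ∀ x : Fin n → ℝ, ∑ p, |x p| ≤ s → (1 + ∑ p, |x p|) * (1 + |F x|) ≤ c} =
        ⋂ x : Fin n → ℝ, ⋂ _ : ∑ p, |x p| ≤ s, Set.Ici ((1 + ∑ p, |x p|) * (1 + |F x|)) by
          ext c; simp]
      exact convex_iInter₂ fun _ _ => convex_Ici _)))
    (fun s => by
      obtain ⟨c, hc⟩ := ((isCompact_closedBall (0 : Fin n → ℝ) (s + 1)).image
        (show Continuous fun x : Fin n → ℝ => (1 + ∑ p, |x p|) * (1 + |F x|) by fun_prop)).bddAbove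
      refine ⟨max 0 c, ?_⟩
      filter_upwards [Iio_mem_nhds (lt_add_one s)] with s' hs'
      refine ⟨Set.mem_Ici.2 (le_max_left _ _), fun x hx => (hc ⟨x, ?_, rfl⟩).trans (le_max_right _ _)⟩
      rw [mem_closedBall_zero_iff]
      exact ((norm_le_sum_abs x).trans hx).trans (le_of_lt hs'))
  exact ⟨ρ, fun x => (hρ _).2 x le_rfl⟩

/-- Every continuous function on `ℝⁿ` is the product of a superposition, with inner functions that
do not depend on it, and a continuous function of the `ℓ¹`-norm. -/
theorem exists_inner_forall_eq_superposition_mul (n : ℕ) :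
    ∃ ψ : Fin (8 * n + 1) → Fin n → C(ℝ, ℝ), ∀ F : C(Fin n → ℝ, ℝ),
      ∃ (Φ : Fin (8 * n + 1) → C(ℝ, ℝ)) (ρ : C(ℝ, ℝ)), ∀ x,
        F x = (∑ q, Φ q (∑ p, ψ q p (x p))) * ρ (∑ p, |x p|) := by
  obtain ⟨ψ, hψ⟩ := exists_inner_forall_eq_superpose n
  refine ⟨fun q p => (ψ q p).comp ⟨_, unitInterval.continuous_sigmoid⟩, fun F => ?_⟩
  obtain ⟨ρ, hρ⟩ := exists_continuous_dominating F
  have hs : ∀ x : Fin n → ℝ, 0 ≤ ∑ p, |x p| := fun x => Finset.sum_nonneg fun _ _ => abs_nonneg _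
  have hρ0 : ∀ x : Fin n → ℝ, 0 < ρ (∑ p, |x p|) := fun x =>
    lt_of_lt_of_le (by have := hs x; positivity) (hρ x)
  -- The factor `1 + ∑ p, |x p|` built into `ρ` forces decay like `(1 + ‖x‖)⁻¹`.
  let h : (Fin n → ℝ) → ℝ := fun x => F x / ρ (∑ p, |x p|)
  have hc : Continuous h := F.continuous.div (by fun_prop) fun x => (hρ0 x).ne'
  have h0 : Filter.Tendsto h (Filter.cocompact _) (nhds 0) := by
    refine squeeze_zero_norm (a := fun x => (1 + ‖x‖)⁻¹) (fun x => ?_)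
      (Filter.tendsto_atTop_add_const_left _ 1 tendsto_norm_cocompact_atTop).inv_tendsto_atTop
    rw [norm_div, Real.norm_eq_abs, Real.norm_eq_abs, abs_of_pos (hρ0 x), div_le_iff₀ (hρ0 x),
      inv_mul_eq_div, le_div_iff₀ (by positivity)]
    have h1 := hρ x
    have h2 := mul_le_mul_of_nonneg_left (norm_le_sum_abs x) (abs_nonneg (F x))
    linarith [hs x]
  have he : Topology.IsOpenEmbedding
      (Pi.map fun _ : Fin n => unitInterval.sigmoid) :=
    Topology.IsOpenEmbedding.piMap fun _ => unitInterval.isOpenEmbedding_sigmoid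
  obtain ⟨Φ, hΦ⟩ := hψ ⟨_, he.continuous_extend_zero hc h0⟩
  refine ⟨Φ, ρ, fun x => ?_⟩
  have h1 := hΦ (Pi.map (fun _ : Fin n => unitInterval.sigmoid) x)
  rw [ContinuousMap.coe_mk, he.injective.extend_apply] at h1
  simp only [Pi.map_apply] at h1
  simp only [ContinuousMap.comp_apply, ContinuousMap.coe_mk]
  rw [← h1, div_mul_cancel₀ _ (hρ0 x).ne']

/-! ### Layers and networks -/

/-- A superposition of any shape that fits is realized by a layer, its inputs and outputs being
placed among the coordinates along `e` and `e'` and padded by zeros. -/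
theorem SuperpositionLayer.exists_eval_extend {ι κ Q : Type*} [Fintype ι] [Fintype Q] {k w : ℕ}
    (e : ι ↪ Fin k) (e' : κ ↪ Fin w) (hQ : Fintype.card Q ≤ 2 * k + 1) (Ψ : Q → ι → C(ℝ, ℝ))
    (Φ : κ → Q → C(ℝ, ℝ)) :
    ∃ s : SuperpositionLayer k w, ∀ x : ι → ℝ, s.eval (Function.extend e x 0) =
      Function.extend e' (fun i => ∑ q, Φ i q (∑ p, Ψ q p (x p))) 0 := by
  obtain ⟨j⟩ := Function.Embedding.nonempty_of_card_le
    (show Fintype.card Q ≤ Fintype.card (Fin (2 * k + 1)) by simpa using hQ)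
  refine ⟨⟨Function.extend j (fun q => Function.extend e (Ψ q) 0) 0,
    Function.extend e' (fun i => Function.extend j (Φ i) 0) 0⟩, fun x => funext fun i => ?_⟩
  by_cases hi : ∃ i₀, e' i₀ = i
  · obtain ⟨i, rfl⟩ := hi
    rw [e'.injective.extend_apply, SuperpositionLayer.eval]
    refine (Fintype.sum_of_injective j j.injective _ _ (fun q hq => ?_) fun q => ?_).symm
    · simp only [e'.injective.extend_apply]
      rw [Function.extend_apply' _ _ _ (by simpa using hq)]
      rfl
    · simp only [e'.injective.extend_apply, j.injective.extend_apply]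
      congr 1
      refine Fintype.sum_of_injective e e.injective _ _ (fun p hp => ?_) fun p => ?_
      · rw [Function.extend_apply' _ _ _ (by simpa using hp)]
        rfl
      · rw [e.injective.extend_apply, e.injective.extend_apply]
  · rw [Function.extend_apply' _ _ _ hi, SuperpositionLayer.eval]
    refine Finset.sum_eq_zero fun q _ => ?_
    simp only [Function.extend_apply' _ _ _ hi]
    rfl

/-- A layer that copies `n` of its inputs to `n` of its outputs. -/
theorem SuperpositionLayer.exists_copy {n k w : ℕ} (e : Fin n ↪ Fin k) (e' : Fin n ↪ Fin w) :
    ∃ s : SuperpositionLayer k w, ∀ x : Fin n → ℝ,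
      s.eval (Function.extend e x 0) = Function.extend e' x 0 := by
  have hnk : n ≤ k := by simpa using Fintype.card_le_of_embedding e
  obtain ⟨s, hs⟩ := SuperpositionLayer.exists_eval_extend (Q := Fin n) e e'
    (by rw [Fintype.card_fin]; omega)
    (fun q p => if q = p then ContinuousMap.id ℝ else 0)
    (fun i q => if i = q then ContinuousMap.id ℝ else 0)
  refine ⟨s, fun x => (hs x).trans ?_⟩
  congr 1
  funext i
  rw [Finset.sum_eq_single i, Finset.sum_eq_single i]
  · simp
  · intro p _ hp
    simp [hp.symm]
  · simp
  · intro p _ hp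
    simp [hp.symm]
  · simp

/-- A layer that multiplies `m` pairs of its inputs. -/
theorem SuperpositionLayer.exists_mul {m w : ℕ} (e : Fin m ⊕ Fin m ↪ Fin w) :
    ∃ s : SuperpositionLayer w m, ∀ x : Fin m ⊕ Fin m → ℝ,
      s.eval (Function.extend e x 0) = fun i => x (.inl i) * x (.inr i) := by
  have hmw : m + m ≤ w := by simpa using Fintype.card_le_of_embedding e
  -- Polarization: `a * b = (a + b) ^ 2 / 4 - (a - b) ^ 2 / 4`.
  let square : C(ℝ, ℝ) := ⟨fun t => t ^ 2 / 4, by fun_prop⟩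
  obtain ⟨s, hs⟩ := SuperpositionLayer.exists_eval_extend (Q := Fin m ⊕ Fin m) e
    (Function.Embedding.refl (Fin m)) (by simp; omega)
    (fun q p => Sum.elim
      (fun i => Sum.elim (Pi.single i (ContinuousMap.id ℝ)) (Pi.single i (ContinuousMap.id ℝ)) p)
      (fun i => Sum.elim (Pi.single i (ContinuousMap.id ℝ)) (Pi.single i (-ContinuousMap.id ℝ)) p)
      q)
    (fun i q => Sum.elim (Pi.single i square) (Pi.single i (-square)) q)
  have hsingle : ∀ (i : Fin m) (c : C(ℝ, ℝ)) (y : Fin m → ℝ),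
      ∑ p, (Pi.single i c : Fin m → C(ℝ, ℝ)) p (y p) = c (y i) := by
    intro i c y
    rw [Finset.sum_eq_single i]
    · simp
    · intro p _ hp
      simp [hp]
    · simp
  refine ⟨s, fun x => (hs x).trans (funext fun i => ?_)⟩
  rw [show i = Function.Embedding.refl (Fin m) i from rfl,
    (Function.Embedding.refl (Fin m)).injective.extend_apply]
  simp only [Fintype.sum_sum_type, Sum.elim_inl, Sum.elim_inr, hsingle]
  simp [square]
  ring

/-- Networks with at least one hidden feature map and wide enough feature maps realize every
continuous mapping of the coordinates selected by an embedding, the others being zero. -/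
theorem SuperpositionNetwork.exists_eval_extend (n m : ℕ) :
    ∃ N : ℕ, n ≤ N ∧ ∀ F : C(Fin n → ℝ, Fin m → ℝ), ∀ ws : List ℕ, ws ≠ [] →
      (∀ w ∈ ws, N ≤ w) → ∀ k, N ≤ k → ∀ e : Fin n ↪ Fin k,
        ∃ net : SuperpositionNetwork k ws m, ∀ x, net.eval (Function.extend e x 0) = F x := by
  obtain ⟨ψ, hψ⟩ := exists_inner_forall_eq_superposition_mul n
  -- This leaves room for `8 * n + 2` inner sums and for the `m + m` factors to be multiplied.
  refine ⟨8 * n + 1 + (m + m), by omega, fun F ws => ?_⟩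
  choose Φ ρ hF using fun i : Fin m => hψ ⟨fun x => F x i, by fun_prop⟩
  induction ws with
  | nil => exact fun h => absurd rfl h
  | cons w ws ih =>
    intro _ hws k hk e
    have hw := hws w List.mem_cons_self
    rcases eq_or_ne ws [] with rfl | hne
    · obtain ⟨e'⟩ : Nonempty (Fin m ⊕ Fin m ↪ Fin w) :=
        Function.Embedding.nonempty_of_card_le (by simp; omega)
      -- The index `none` carries the `ℓ¹`-norm, fed to `ρ i`; the others carry the superposition
      -- factor.
      obtain ⟨s, hs⟩ := SuperpositionLayer.exists_eval_extend (Q := Option (Fin (8 * n + 1))) e e'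
        (by simp; omega)
        (fun q p => q.elim ⟨fun t => |t|, continuous_abs⟩ fun q => ψ q p)
        (fun i q => Sum.elim (fun i => q.elim 0 (Φ i)) (fun i => q.elim (ρ i) 0) i)
      obtain ⟨s', hs'⟩ := SuperpositionLayer.exists_mul e'
      refine ⟨.cons s (.output s'), fun x => ?_⟩
      change s'.eval (s.eval _) = _
      rw [hs, hs']
      funext i
      have := hF i x
      simp only [ContinuousMap.coe_mk] at this
      rw [this]
      simp [Fintype.sum_option]
    · let e' : Fin n ↪ Fin w := Fin.castLEEmb (by omega)
      obtain ⟨s, hs⟩ := SuperpositionLayer.exists_copy e e'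
      obtain ⟨net, hnet⟩ := ih hne (fun v hv => hws v (List.mem_cons_of_mem _ hv)) w hw e'
      refine ⟨.cons s net, fun x => ?_⟩
      change net.eval (s.eval _) = _
      rw [hs, hnet]

theorem corollary1 (n m : ℕ) :
    ∃ N : ℕ, ∀ ws : List ℕ, N ≤ ws.length → (∀ w ∈ ws, N ≤ w) →
      ∀ (A : Set (Fin n → ℝ)) (B : Set (Fin m → ℝ)), IsClosed A →
        ∀ f : A → B, Continuous f →
          ∃ net : SuperpositionNetwork n ws m, ∀ x : A, net.eval (x : Fin n → ℝ) = f x := by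
  obtain ⟨N, hnN, hN⟩ := SuperpositionNetwork.exists_eval_extend n m
  -- The input width `n` allows only `2 * n + 1` inner sums, so the first layer just copies into a
  -- wide feature map. Two hidden feature maps ensure that one is left after it.
  refine ⟨N + 2, fun ws hlen hws A B hA f hf => ?_⟩
  obtain ⟨F, hF⟩ := ContinuousMap.exists_restrict_eq hA
    (⟨fun x => (f x : Fin m → ℝ), by fun_prop⟩ : C(A, Fin m → ℝ))
  match ws, hlen, hws with
  | w :: ws, hlen, hws =>
    have hw := hws w List.mem_cons_self
    let e : Fin n ↪ Fin w := Fin.castLEEmb (by omega)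
    obtain ⟨s, hs⟩ := SuperpositionLayer.exists_copy (Function.Embedding.refl (Fin n)) e
    obtain ⟨net, hnet⟩ := hN F ws (by rintro rfl; simp at hlen)
      (fun v hv => le_trans (by omega) (hws v (List.mem_cons_of_mem _ hv))) w (by omega) e
    refine ⟨.cons s net, fun x => ?_⟩
    have hx : Function.extend (Function.Embedding.refl (Fin n)) (x : Fin n → ℝ) 0 = x :=
      funext fun i => (Function.Embedding.refl (Fin n)).injective.extend_apply _ _ i
    change net.eval (s.eval _) = _
    rw [← hx, hs, hnet]
    exact congrArg (fun g : C(A, Fin m → ℝ) => g x) hF
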